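/- **Conventions.** Let $I=[0,1]$; path spaces $X^I$ carry the compact-open topology (for a metric space $X$, the topology of the sup metric). For a metric space $X$ and $k\ge 1$, let $\mathcal B_k(X)$ be the space of probability measures on $X$ supported on at most $k$ points, $\mu=\sum a_i x_i$, with the Lévy–Prokhorov metric; $\operatorname{supp}(\mu)$ is the set of points of positive mass. Invariants below take values in $\{0,1,2,\dots\}\cup\{\infty\}$, the value being $\infty$ if no integer $n$ as required exists, and $(\infty+1)^2-1=\infty$. Fix an integer $r\ge 2$ and put $t_i=\frac{i-1}{r-1}$ for $1\le i\le r$. *Parametrized complexity.* For a map $p\colon E\to B$ with $E$ a metric space, let $E^r_B=\{(e_1,\dots,e_r)\in E^r : p(e_i)=p(e_j)\ \text{for all } i,j\}$ and let $E^I_B\subset E^I$ be the subspace of paths lying in a single fiber of $p$. Then $\mathrm{dTC}_r[p\colon E\to B]$ is the smallest integer $n\ge 0$ for which there is a continuous map $s\colon E^r_B\to\mathcal B_{n+1}(E^I_B)$ such that, for every $(e_1,\dots,e_r)\in E^r_B$, every path $\gamma\in\operatorname{supp}\, s(e_1,\dots,e_r)$ satisfies $\gamma(t_i)=e_i$ for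 all $i$. *Equivariant complexity.* Let $G$ be a topological group and $F$ a metric space with a continuous $G$-action. Let $G$ act diagonally on $F^r$, pointwise on $F^I$, and by push-forward, $g\cdot\sum a_\phi\phi=\sum a_\phi\, g\phi$, on $\mathcal B_k(F^I)$. Then $\mathrm{dTC}_{G,r}(F)$ is the smallest integer $n\ge 0$ for which there is a continuous $G$-equivariant map $s\colon F^r\to\mathcal B_{n+1}(F^I)$ such that, for every $(f_1,\dots,f_r)\in F^r$, every path $\phi\in\operatorname{supp}\, s(f_1,\dots,f_r)$ satisfies $\phi(t_i)=f_i$ for all $i$. **Theorem.** Let $G$ be a topological group, let $q\colon P\to B$ be a (locally trivial) principal $G$-bundle, so that $B=P/G$, and let $F$ be a metric space with a continuous $G$-action. Let $E=F\times_G P=(F\times P)/G$ be the orbit space of the diagonal action, assume that its topology is induced by a metric, and fix such a metric. Let $p\colon E=F\times_G P\to P/G=B$, $p([f,y])=q(y)$, be the associated bundle with fiber $F$ and structure group $G$. Then for every $r\ge 2$, $$\mathrm{dTC}_r[p\colon F\times_G P\to P/G]\;\le\;\bigl(\mathrm{dTC}_{G,r}(F)+1\bigr)^2-1 .$$ -/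

import Mathlib

open MeasureTheory Topology
open scoped unitInterval

namespace DistTC

/-- The Borel σ-algebra on a path space `C(I, X)` (compact-open topology, which for a metric
space `X` is the topology of the sup metric). -/
instance instMeasurableSpacePath {X : Type*} [TopologicalSpace X] :
    MeasurableSpace C(I, X) := borel _

instance instBorelSpacePath {X : Type*} [TopologicalSpace X] : BorelSpace C(I, X) := ⟨rfl⟩

/-- `DistMeasure k X` is the space `𝓑ₖ(X)` of probability measures on the metric space `X` that
are supported on at most `k` points, with the topology of the Lévy–Prokhorov metric. -/
abbrev DistMeasure (k : ℕ) (X : Type*) [MetricSpace X] [MeasurableSpace X] [BorelSpace X] :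
    Type _ :=
  {μ : LevyProkhorov (ProbabilityMeasure X) //
    ∃ S : Finset X, S.card ≤ k ∧ (μ.toMeasure : Measure X) (S : Set X)ᶜ = 0}

/-- The support of a finitely supported measure `∑ aᵢ xᵢ`: the points of positive mass. -/
def DistMeasure.supp {k : ℕ} {X : Type*} [MetricSpace X] [MeasurableSpace X] [BorelSpace X]
    (μ : DistMeasure k X) : Set X :=
  {x | (μ.1.toMeasure : Measure X) {x} ≠ 0}

/-- The push-forward action `g • ∑ aᵢ xᵢ = ∑ aᵢ (g • xᵢ)` on `𝓑ₖ(X)`. -/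
noncomputable instance DistMeasure.instSMul {G : Type*} [Group G] {k : ℕ} {X : Type*}
    [MetricSpace X] [MeasurableSpace X] [BorelSpace X] [MulAction G X] [ContinuousConstSMul G X] :
    SMul G (DistMeasure k X) where
  smul g μ :=
    ⟨LevyProkhorov.ofMeasure
      (μ.1.toMeasure.map (f := fun x : X => g • x)
        (continuous_const_smul g).measurable.aemeasurable), by
      classical
      obtain ⟨S, hS, h0⟩ := μ.2
      refine ⟨S.image (fun x => g • x), Finset.card_image_le.trans hS, ?_⟩
      have hm : MeasurableSet (((S.image (fun x => g • x) : Finset X) : Set X)ᶜ) :=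
        (Finset.measurableSet _).compl
      rw [ProbabilityMeasure.toMeasure_map,
        Measure.map_apply (continuous_const_smul g).measurable hm]
      refine measure_mono_null ?_ h0
      intro x hx hxS
      exact hx (Finset.mem_coe.2 (Finset.mem_image_of_mem (fun x => g • x) (Finset.mem_coe.1 hxS)))⟩

/-- `s : Y → 𝓑ₖ(X)` is a continuous section of `𝓑ₖ(p)`, that is, the measure `s y` is supported
in the fibre `p ⁻¹(y)` for every `y`. -/
def IsDistSection {k : ℕ} {X Y : Type*} [MetricSpace X] [MeasurableSpace X] [BorelSpace X]
    [TopologicalSpace Y] (p : X → Y) (s : C(Y, DistMeasure k X)) : Prop :=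
  ∀ y, (s y).supp ⊆ p ⁻¹' {y}

/-- The equivariant distributional sectional category of a `G`-map `p : X → Y`: the smallest `n`
such that `𝓑ₙ₊₁(p)` has a `G`-equivariant section (`⊤` if there is no such `n`). -/
noncomputable def dsecatG (G : Type*) [Group G] {X Y : Type*} [MetricSpace X] [MeasurableSpace X]
    [BorelSpace X] [MulAction G X] [ContinuousConstSMul G X] [TopologicalSpace Y] [MulAction G Y]
    (p : X → Y) : ℕ∞ :=
  sInf {N : ℕ∞ | ∃ n : ℕ, N = n ∧ ∃ s : C(Y, DistMeasure (n + 1) X),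
    IsDistSection p s ∧ ∀ (g : G) (y : Y), s (g • y) = g • s y}

/-- The time `i / (r - 1)`, where `i` runs through `0, …, r - 1`. -/
noncomputable def seqTime (r : ℕ) (i : Fin r) : I :=
  ⟨(i : ℝ) / ((r : ℝ) - 1), by
    have h : ((i : ℕ) : ℝ) + 1 ≤ r := by exact_mod_cast i.2
    have h0 : (0 : ℝ) ≤ ((i : ℕ) : ℝ) := Nat.cast_nonneg _
    exact unitInterval.div_mem h0 (by linarith) (by linarith)⟩

/-- The path fibration `π_r : X^I → X^r`, `φ ↦ (φ (i / (r - 1)))ᵢ`. -/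
noncomputable def pathEval (r : ℕ) (X : Type*) [TopologicalSpace X] (φ : C(I, X)) : Fin r → X :=
  fun i => φ (seqTime r i)

/-- The `r`-th sequential equivariant distributional complexity of a `G`-space `F`.  The group
acts on paths pointwise and on `F^r` diagonally. -/
noncomputable def equivariantDTC (G : Type*) [Group G] (r : ℕ) (F : Type*) [MetricSpace F]
    [MulAction G F] [ContinuousConstSMul G F] : ℕ∞ :=
  dsecatG G (pathEval r F)

/-- The space `E^I_B` of paths in `E` that lie in a single fibre of `p`. -/
abbrev FiberPath {E B : Type*} [TopologicalSpace E] (p : E → B) : Type _ :=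
  {γ : C(I, E) // ∃ b : B, ∀ t, p (γ t) = b}

/-- The fibre product `E^r_B`. -/
abbrev FiberProd {E B : Type*} (r : ℕ) (p : E → B) : Type _ :=
  {e : Fin r → E // ∀ i j, p (e i) = p (e j)}

/-- The set `E^I_B(e₁, …, e_r)` of fibrewise paths that pass through the points `eᵢ` at the
prescribed times. -/
def fiberPathsThrough {E B : Type*} [TopologicalSpace E] {r : ℕ} {p : E → B} (e : FiberProd r p) :
    Set (FiberPath p) :=
  {γ | ∀ i, γ.1 (seqTime r i) = e.1 i}

/-- An `r`-th sequential parametrized `k`-distributed navigation algorithm for `p : E → B`. -/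
def IsNavigationAlgorithm {E B : Type*} [MetricSpace E] {r k : ℕ} {p : E → B}
    (s : C(FiberProd r p, DistMeasure k (FiberPath p))) : Prop :=
  ∀ e, (s e).supp ⊆ fiberPathsThrough e

/-- The `r`-th sequential parametrized distributional complexity `dTC_r[p : E → B]`: the smallest
`n` such that `p` has an `r`-th sequential parametrized `(n+1)`-distributed navigation algorithm
(`⊤` if there is no such `n`). -/
noncomputable def parametrizedDTC {E B : Type*} [MetricSpace E] (r : ℕ) (p : E → B) : ℕ∞ :=
  sInf {N : ℕ∞ | ∃ n : ℕ, N = n ∧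
    ∃ s : C(FiberProd r p, DistMeasure (n + 1) (FiberPath p)), IsNavigationAlgorithm s}

/-- `q : P → B` is a (locally trivial) principal `G`-bundle: `G` acts along the fibres of `q` and
`q` has local trivializations `q ⁻¹(U) ≅ U × G` that are `G`-equivariant, where `G` acts on itself
by translation. -/
structure IsPrincipalBundle (G : Type*) [Group G] [TopologicalSpace G] {P B : Type*}
    [TopologicalSpace P] [TopologicalSpace B] [MulAction G P] (q : P → B) : Prop where
  proj_smul : ∀ (g : G) (y : P), q (g • y) = q y
  exists_trivialization : ∀ b : B, ∃ e : Bundle.Trivialization G q, b ∈ e.baseSet ∧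
    ∀ (g : G), ∀ y ∈ e.source, (e (g • y)).2 = g * (e y).2

/-- The associated space `F ×_G P`, the orbit space of the diagonal action on `F × P` (with the
quotient topology). -/
abbrev AssociatedSpace (G F P : Type*) [Group G] [MulAction G F] [MulAction G P] : Type _ :=
  MulAction.orbitRel.Quotient G (F × P)

/-- The class `[f, y]` in `F ×_G P`. -/
def AssociatedSpace.mk (G : Type*) {F P : Type*} [Group G] [MulAction G F] [MulAction G P]
    (f : F) (y : P) : AssociatedSpace G F P :=
  Quotient.mk (MulAction.orbitRel G (F × P)) (f, y)

end DistTC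

open Set Metric Filter
open scoped ENNReal

set_option linter.unusedSectionVars false

/-! The stronger bound without the square holds: the parametrized complexity of the associated
bundle is at most the equivariant complexity of the fibre, and `N ≤ (N + 1) ^ 2 - 1` for every `N`.
Given an equivariant section `s`, write points over a common base point as `[fᵢ, y]` and push `s f`
forward along `φ ↦ [φ, y]`. Another choice `(g • f, g • y)` gives the same measure by equivariance
(`map_fiberPathMap_eq`), so arbitrary choices define a global map. Its continuity is local:
`exists_local_coordinate` makes the choices continuous, and `continuous_map_uncurry` makes
push-forward jointly continuous in map and measure. Push-forward does not enlarge the support, so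
the size bound is unchanged. -/

namespace DistTC

/-! ### Push-forward of finitely supported measures. -/

namespace DistMeasure

variable {k : ℕ} {X Y W : Type*} [MetricSpace X] [MeasurableSpace X] [BorelSpace X]
  [MetricSpace Y] [MeasurableSpace Y] [BorelSpace Y] [TopologicalSpace W]

/-- The push-forward of a finitely supported measure along a continuous map. -/
noncomputable def map (f : C(X, Y)) (μ : DistMeasure k X) : DistMeasure k Y :=
  ⟨LevyProkhorov.ofMeasure (μ.1.toMeasure.map (f := f) f.continuous.measurable.aemeasurable), by
    classical
    obtain ⟨S, hS, h0⟩ := μ.2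
    refine ⟨S.image f, Finset.card_image_le.trans hS, ?_⟩
    rw [ProbabilityMeasure.toMeasure_map,
      Measure.map_apply f.continuous.measurable (Finset.measurableSet _).compl]
    refine measure_mono_null ?_ h0
    intro x hx hxS
    exact hx (Finset.mem_coe.2 (Finset.mem_image_of_mem f (Finset.mem_coe.1 hxS)))⟩

theorem map_toMeasure_apply (f : C(X, Y)) (μ : DistMeasure k X) {A : Set Y}
    (hA : MeasurableSet A) :
    ((map f μ).1.toMeasure : Measure Y) A = (μ.1.toMeasure : Measure X) (f ⁻¹' A) := by
  change ((μ.1.toMeasure.map (f := f) f.continuous.measurable.aemeasurable :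
    ProbabilityMeasure Y) : Measure Y) A = _
  rw [ProbabilityMeasure.toMeasure_map, Measure.map_apply f.continuous.measurable hA]

theorem ext_of_measure {μ ν : DistMeasure k X}
    (h : ∀ A : Set X, MeasurableSet A →
      (μ.1.toMeasure : Measure X) A = (ν.1.toMeasure : Measure X) A) : μ = ν := by
  apply Subtype.ext
  apply LevyProkhorov.toMeasure_injective
  apply ProbabilityMeasure.toMeasure_injective
  exact Measure.ext h

theorem smul_toMeasure_apply {G : Type*} [Group G] [MulAction G X] [ContinuousConstSMul G X]
    (g : G) (μ : DistMeasure k X) {A : Set X} (hA : MeasurableSet A) :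
    ((g • μ).1.toMeasure : Measure X) A = (μ.1.toMeasure : Measure X) ((g • ·) ⁻¹' A) := by
  change ((μ.1.toMeasure.map (f := fun x : X => g • x)
    (continuous_const_smul g).measurable.aemeasurable : ProbabilityMeasure X) : Measure X) A = _
  rw [ProbabilityMeasure.toMeasure_map,
    Measure.map_apply (continuous_const_smul g).measurable hA]

theorem map_smul_eq {G : Type*} [Group G] [MulAction G X] [ContinuousConstSMul G X]
    (g : G) (μ : DistMeasure k X) (f f' : C(X, Y)) (h : ∀ x, f (g • x) = f' x) :
    map f (g • μ) = map f' μ := by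
  refine ext_of_measure fun A hA => ?_
  rw [map_toMeasure_apply _ _ hA, map_toMeasure_apply _ _ hA,
    smul_toMeasure_apply _ _ (f.continuous.measurable hA), ← preimage_comp]
  congr 2
  exact funext h

/-- The fibre of `f` over `y` may be uncountable, but all mass sits on a finite set, so a fibre of
positive mass contains an atom. -/
theorem exists_mem_supp_of_mem_supp_map {f : C(X, Y)} {μ : DistMeasure k X} {y : Y}
    (hy : y ∈ (map f μ).supp) : ∃ x ∈ μ.supp, f x = y := by
  by_contra! hne
  apply hy
  rw [map_toMeasure_apply _ _ (measurableSet_singleton y)]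
  obtain ⟨S, -, hS⟩ := μ.2
  have hnull : (μ.1.toMeasure : Measure X) (⋃ x ∈ {x | x ∈ S ∧ f x = y}, {x}) = 0 := by
    rw [measure_biUnion_null_iff ((S.finite_toSet.subset fun x hx => hx.1).countable)]
    intro x hx
    by_contra h0
    exact hne x h0 hx.2
  refine measure_mono_null (fun x hx => ?_) (measure_union_null hnull hS)
  by_cases hxS : x ∈ S
  · exact Or.inl (mem_biUnion (show x ∈ {x | x ∈ S ∧ f x = y} from ⟨hxS, hx⟩) rfl)
  · exact Or.inr hxS

/-- Push-forward along a continuous family of maps is jointly continuous for the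
Lévy–Prokhorov metric. -/
theorem continuous_map_uncurry (Φ : W → C(X, Y))
    (hΦ : Continuous fun a : W × X => Φ a.1 a.2) :
    Continuous fun a : W × DistMeasure k X => map (Φ a.1) a.2 := by
  rw [continuous_iff_continuousAt]
  rintro ⟨w₀, μ₀⟩
  rw [ContinuousAt, Metric.tendsto_nhds]
  intro ε hε
  obtain ⟨S, -, hS⟩ := μ₀.2
  -- Joint continuity gives control near each single point; since `μ₀` lives on the finite set `S`,
  -- one radius and one neighbourhood of `w₀` serve all of `S`.
  have hloc : ∀ x : X, ∃ δ > 0, ∀ᶠ w in 𝓝 w₀, ∀ z, dist z x < δ →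
      dist (Φ w z) (Φ w₀ x) < ε / 2 := by
    intro x
    have := (Metric.tendsto_nhds.1 (hΦ.tendsto (w₀, x))) (ε / 2) (half_pos hε)
    rw [nhds_prod_eq, eventually_prod_iff] at this
    obtain ⟨pa, hpa, pb, hpb, hp⟩ := this
    obtain ⟨δ, hδ, hb⟩ := Metric.eventually_nhds_iff.1 hpb
    exact ⟨δ, hδ, hpa.mono fun w hw z hz => hp hw (hb hz)⟩
  choose δ hδ hΦδ using hloc
  obtain ⟨η, hη, hηε, hηδ⟩ : ∃ η > 0, η ≤ ε / 2 ∧ ∀ x ∈ S, η ≤ δ x := by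
    rcases S.eq_empty_or_nonempty with rfl | hne
    · exact ⟨ε / 2, half_pos hε, le_rfl, by simp⟩
    · exact ⟨min (ε / 2) (S.inf' hne δ),
        lt_min (half_pos hε) ((Finset.lt_inf'_iff _).2 fun x _ => hδ x), min_le_left _ _,
        fun x hx => (min_le_right _ _).trans (Finset.inf'_le _ hx)⟩
  have hw : ∀ᶠ w in 𝓝 w₀, ∀ x ∈ S, ∀ z, dist z x < η → dist (Φ w z) (Φ w₀ x) < ε / 2 :=
    (S.eventually_all).2 fun x hx =>
      (hΦδ x).mono fun w hw z hz => hw z (hz.trans_le (hηδ x hx))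
  rw [nhds_prod_eq]
  filter_upwards [hw.prod_mk (Metric.ball_mem_nhds μ₀ hη)]
  rintro ⟨w, μ⟩ ⟨hw, hμ⟩
  refine lt_of_le_of_lt ?_ (half_lt_self hε)
  rw [Subtype.dist_eq, LevyProkhorov.dist_probabilityMeasure_def]
  -- For probability measures one of the two Lévy–Prokhorov inequalities suffices.
  refine levyProkhorovDist_le_of_forall_le _ _ (half_pos hε).le fun ε' A hε' hA => ?_
  rw [map_toMeasure_apply _ _ hA, map_toMeasure_apply _ _ isOpen_thickening.measurableSet]
  have hLP : levyProkhorovEDist (μ.1.toMeasure : Measure X) (μ₀.1.toMeasure : Measure X)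
      < ENNReal.ofReal η := by
    rw [← LevyProkhorov.edist_probabilityMeasure_def, edist_dist]
    exact (ENNReal.ofReal_lt_ofReal_iff hη).2 hμ
  have h1 := left_measure_le_of_levyProkhorovEDist_lt hLP ((Φ w).continuous.measurable hA)
  rw [ENNReal.toReal_ofReal hη.le] at h1
  -- A point of `S` within `η` of `Φ w ⁻¹' A` is sent by `Φ w₀` to within `ε / 2` of `A`; points off
  -- `S` carry no `μ₀`-mass.
  refine h1.trans (add_le_add ?_ (ENNReal.ofReal_le_ofReal (hηε.trans hε'.le)))
  refine (measure_mono (t := (Φ w₀ ⁻¹' thickening ε' A) ∪ (S : Set X)ᶜ) fun x hx => ?_).trans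
    ((measure_union_le _ _).trans (by rw [hS, add_zero]))
  by_cases hxS : x ∈ S
  · left
    obtain ⟨z, hzA, hz⟩ := mem_thickening_iff.1 hx
    refine mem_thickening_iff.2 ⟨Φ w z, hzA, ?_⟩
    rw [dist_comm] at hz ⊢
    exact (hw x hxS z hz).trans hε'
  · exact Or.inr hxS

end DistMeasure

/-! ### Principal bundles and their associated bundles. -/

section Associated

variable {G F P E B : Type*} [Group G] [TopologicalSpace G] [IsTopologicalGroup G]
  [MetricSpace F] [MulAction G F] [ContinuousSMul G F]
  [TopologicalSpace P] [MulAction G P] [ContinuousSMul G P]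
  [TopologicalSpace B] [MetricSpace E] {q : P → B} {p : E → B}

namespace IsPrincipalBundle

theorem surjective (hq : IsPrincipalBundle G q) : Function.Surjective q := fun b => by
  obtain ⟨T, hb, -⟩ := hq.exists_trivialization b
  obtain ⟨y, -, hy⟩ := T.proj_surjOn_baseSet hb
  exact ⟨y, hy⟩

theorem exists_smul_eq (hq : IsPrincipalBundle G q) {y y' : P} (h : q y = q y') :
    ∃ g : G, g • y = y' := by
  obtain ⟨T, hb, hT⟩ := hq.exists_trivialization (q y)
  have hy : y ∈ T.source := T.mem_source.2 hb
  have hy' : y' ∈ T.source := T.mem_source.2 (h ▸ hb)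
  -- The quotient of the two fibre coordinates in a common trivialization.
  refine ⟨(T y').2 * (T y).2⁻¹, ?_⟩
  have hgy : ((T y').2 * (T y).2⁻¹) • y ∈ T.source :=
    T.mem_source.2 (by rwa [hq.proj_smul])
  refine T.injOn hgy hy' (Prod.ext ?_ ?_)
  · change (T _).1 = (T _).1
    rw [T.coe_fst hgy, T.coe_fst hy', hq.proj_smul, h]
  · change (T _).2 = (T _).2
    rw [hT _ _ hy, inv_mul_cancel_right]

theorem eq_one_of_smul_eq (hq : IsPrincipalBundle G q) {g : G} {y : P} (h : g • y = y) :
    g = 1 := by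
  obtain ⟨T, hb, hT⟩ := hq.exists_trivialization (q y)
  have := hT g y (T.mem_source.2 hb)
  rw [h] at this
  exact (right_eq_mul.1 this)

end IsPrincipalBundle

theorem AssociatedSpace.mk_smul (g : G) (f : F) (y : P) :
    AssociatedSpace.mk G (g • f) (g • y) = AssociatedSpace.mk G f y :=
  Quotient.sound ⟨g, rfl⟩

theorem AssociatedSpace.mk_left_injective (hq : IsPrincipalBundle G q) (y : P) :
    Function.Injective fun f : F => AssociatedSpace.mk G f y := by
  intro f f' h
  obtain ⟨g, hg⟩ := Quotient.exact h
  have hy : g • y = y := congrArg Prod.snd hg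
  have hf : g • f' = f := congrArg Prod.fst hg
  rw [hq.eq_one_of_smul_eq hy, one_smul] at hf
  exact hf.symm

theorem AssociatedSpace.continuous_mk :
    Continuous fun a : F × P => AssociatedSpace.mk G a.1 a.2 :=
  continuous_quot_mk

theorem exists_homeomorph_mk_eq (h : AssociatedSpace G F P ≃ₜ E)
    (hp : ∀ (f : F) (y : P), p (h (AssociatedSpace.mk G f y)) = q y)
    (hq : IsPrincipalBundle G q) {y : P} {e : E} (hy : q y = p e) :
    ∃ f : F, h (AssociatedSpace.mk G f y) = e := by
  obtain ⟨⟨f', y'⟩, hfy⟩ := Quotient.exists_rep (h.symm e)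
  have he : h (AssociatedSpace.mk G f' y') = e := by
    rw [← h.apply_symm_apply e, ← hfy]; rfl
  obtain ⟨g, rfl⟩ := hq.exists_smul_eq (y := y') (y' := y) (by rw [hy, ← he, hp])
  exact ⟨g • f', by rw [AssociatedSpace.mk_smul, he]⟩

/-- Openness allows continuity at a single point of `E` to be tested on `F × P`. -/
theorem isOpenQuotientMap_homeomorph_mk (h : AssociatedSpace G F P ≃ₜ E) :
    IsOpenQuotientMap fun a : F × P => h (AssociatedSpace.mk G a.1 a.2) :=
  h.isOpenQuotientMap.comp MulAction.isOpenQuotientMap_quotientMk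

theorem IsPrincipalBundle.continuous (hq : IsPrincipalBundle G q) : Continuous q := by
  rw [continuous_iff_continuousAt]
  intro y
  obtain ⟨T, hb, -⟩ := hq.exists_trivialization (q y)
  exact T.continuousAt_proj (T.mem_source.2 hb)

theorem continuous_associated_proj (h : AssociatedSpace G F P ≃ₜ E)
    (hp : ∀ (f : F) (y : P), p (h (AssociatedSpace.mk G f y)) = q y)
    (hq : IsPrincipalBundle G q) : Continuous p := by
  rw [← (isOpenQuotientMap_homeomorph_mk h).continuous_comp_iff]
  exact (hq.continuous.comp continuous_snd).congr fun a => (hp a.1 a.2).symm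

/-- Over small open sets of the base, the associated bundle has a continuous fibre coordinate
relative to a continuous local section of the principal bundle. -/
theorem exists_local_coordinate (h : AssociatedSpace G F P ≃ₜ E)
    (hp : ∀ (f : F) (y : P), p (h (AssociatedSpace.mk G f y)) = q y)
    (hq : IsPrincipalBundle G q) (b : B) :
    ∃ U : Set B, IsOpen U ∧ b ∈ U ∧ ∃ (sec : B → P) (θ : E → F), ContinuousOn sec U ∧
      (∀ x ∈ U, q (sec x) = x) ∧ ContinuousOn θ (p ⁻¹' U) ∧
      ∀ e, p e ∈ U → h (AssociatedSpace.mk G (θ e) (sec (p e))) = e := by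
  classical
  obtain ⟨T, hb, hT⟩ := hq.exists_trivialization b
  -- The local section whose fibre coordinate is `1`.
  set sec : B → P := fun x => T.toOpenPartialHomeomorph.symm (x, 1) with h_sec
  have hq_sec : ∀ x ∈ T.baseSet, q (sec x) = x := fun x hx => T.proj_symm_apply' hx
  have hT_sec : ∀ y ∈ T.source, (T y).2 • sec (q y) = y := by
    intro y hy
    have hby := T.mem_source.1 hy
    have h_sec_mem : sec (q y) ∈ T.source := T.mem_source.2 (by rwa [hq_sec _ hby])
    have hgs : (T y).2 • sec (q y) ∈ T.source :=
      T.mem_source.2 (by rwa [hq.proj_smul, hq_sec _ hby])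
    refine T.injOn hgs hy (Prod.ext ?_ ?_)
    · change (T _).1 = (T _).1
      rw [T.coe_fst hgs, T.coe_fst hy, hq.proj_smul, hq_sec _ hby]
    · change (T _).2 = (T _).2
      rw [hT _ _ h_sec_mem, h_sec, T.apply_symm_apply' hby, mul_one]
  have hθ : ∀ e : E, ∃ f : F, p e ∈ T.baseSet →
      h (AssociatedSpace.mk G f (sec (p e))) = e := by
    intro e
    by_cases he : p e ∈ T.baseSet
    · obtain ⟨f, hf⟩ := exists_homeomorph_mk_eq h hp hq (hq_sec _ he)
      exact ⟨f, fun _ => hf⟩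
    -- Off the base set any value will do; a representative of `e` shows that `F` is nonempty.
    · obtain ⟨⟨f, -⟩, -⟩ := Quotient.exists_rep (h.symm e)
      exact ⟨f, fun h' => absurd h' he⟩
  choose θ hθ using hθ
  refine ⟨T.baseSet, T.open_baseSet, hb, sec, θ, ?_, hq_sec, ?_, hθ⟩
  · exact T.continuousOn_symm_prodMk_left
  · intro e he
    refine ContinuousAt.continuousWithinAt ?_
    obtain ⟨⟨f, y⟩, rfl⟩ := (isOpenQuotientMap_homeomorph_mk h).surjective e
    rw [← (isOpenQuotientMap_homeomorph_mk h).continuousAt_comp_iff]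
    have hy : y ∈ T.source := T.mem_source.2 (by simpa [hp] using he)
    -- Upstairs the coordinate is explicit: `y = (T y).2 • sec (q y)` gives `[f, y] = [(T y).2⁻¹ •
    -- f, sec (q y)]`.
    have hc : ContinuousAt (fun a : F × P => (T a.2).2⁻¹ • a.1) (f, y) := by
      have hTy : ContinuousAt (fun a : F × P => T a.2) (f, y) :=
        ContinuousAt.comp (f := Prod.snd) (x := (f, y))
          (T.toOpenPartialHomeomorph.continuousAt hy) continuousAt_snd
      exact (hTy.snd.inv).smul continuousAt_fst
    refine hc.congr ?_
    have hev : ∀ᶠ a : F × P in 𝓝 (f, y), a.2 ∈ T.source :=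
      continuousAt_snd.eventually (T.open_source.mem_nhds hy)
    filter_upwards [hev] with a ha
    have hpa : p (h (AssociatedSpace.mk G a.1 a.2)) = q a.2 := hp _ _
    apply AssociatedSpace.mk_left_injective hq (sec (q a.2))
    apply h.injective
    have h1 := hθ (h (AssociatedSpace.mk G a.1 a.2)) (hpa ▸ T.mem_source.1 ha)
    rw [hpa] at h1
    refine Eq.trans ?_ h1.symm
    change h (AssociatedSpace.mk G ((T a.2).2⁻¹ • a.1) (sec (q a.2))) = _
    rw [← AssociatedSpace.mk_smul (T a.2).2, smul_inv_smul, hT_sec _ ha]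

/-- The path `t ↦ [φ t, y]` in the fibre over `q y`. -/
def fiberPathMap (h : AssociatedSpace G F P ≃ₜ E)
    (hp : ∀ (f : F) (y : P), p (h (AssociatedSpace.mk G f y)) = q y) (y : P) :
    C(C(I, F), FiberPath p) where
  toFun φ := ⟨⟨fun t => h (AssociatedSpace.mk G (φ t) y),
    h.continuous.comp (AssociatedSpace.continuous_mk.comp (φ.continuous.prodMk continuous_const))⟩,
    q y, fun _ => hp _ _⟩
  continuous_toFun := by
    refine Continuous.subtype_mk (ContinuousMap.continuous_of_continuous_uncurry _ ?_) _
    exact h.continuous.comp (AssociatedSpace.continuous_mk.comp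
      (Continuous.prodMk (by fun_prop) continuous_const))

theorem continuous_fiberPathMap_uncurry (h : AssociatedSpace G F P ≃ₜ E)
    (hp : ∀ (f : F) (y : P), p (h (AssociatedSpace.mk G f y)) = q y) :
    Continuous fun a : P × C(I, F) => fiberPathMap h hp a.1 a.2 := by
  refine Continuous.subtype_mk (ContinuousMap.continuous_of_continuous_uncurry _ ?_) _
  exact h.continuous.comp (AssociatedSpace.continuous_mk.comp
    (Continuous.prodMk (by fun_prop) (by fun_prop)))

theorem fiberPathMap_smul (h : AssociatedSpace G F P ≃ₜ E)
    (hp : ∀ (f : F) (y : P), p (h (AssociatedSpace.mk G f y)) = q y) (g : G) (y : P)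
    (φ : C(I, F)) : fiberPathMap h hp (g • y) (g • φ) = fiberPathMap h hp y φ :=
  Subtype.ext (ContinuousMap.ext fun t => congrArg h (AssociatedSpace.mk_smul g (φ t) y))

/-- The push-forward of an equivariant section depends only on the points `[fᵢ, y]`. -/
theorem map_fiberPathMap_eq (h : AssociatedSpace G F P ≃ₜ E)
    (hp : ∀ (f : F) (y : P), p (h (AssociatedSpace.mk G f y)) = q y)
    (hq : IsPrincipalBundle G q) {ι : Type*} {k : ℕ} {s : (ι → F) → DistMeasure k C(I, F)}
    (hs : ∀ (g : G) (f : ι → F), s (g • f) = g • s f) {y y' : P} (hy : q y = q y')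
    {f f' : ι → F}
    (hf : ∀ i, h (AssociatedSpace.mk G (f i) y) = h (AssociatedSpace.mk G (f' i) y')) :
    DistMeasure.map (fiberPathMap h hp y) (s f) = DistMeasure.map (fiberPathMap h hp y') (s f') := by
  obtain ⟨g, rfl⟩ := hq.exists_smul_eq hy
  -- Freeness of the action on `P` makes the fibre coordinate over `g • y` unique, so the same `g`
  -- works for all `i`.
  have hgf : f' = g • f := by
    funext i
    apply AssociatedSpace.mk_left_injective hq (g • y)
    exact (h.injective (hf i)).symm.trans (AssociatedSpace.mk_smul g (f i) y).symm
  rw [hgf, hs]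
  exact (DistMeasure.map_smul_eq g (s f) _ _ (fiberPathMap_smul h hp g y)).symm

/-- An equivariant distributed section of the path fibration of the fibre induces a distributed
navigation algorithm on the associated bundle. -/
theorem exists_isNavigationAlgorithm (h : AssociatedSpace G F P ≃ₜ E)
    (hp : ∀ (f : F) (y : P), p (h (AssociatedSpace.mk G f y)) = q y)
    (hq : IsPrincipalBundle G q) {r k : ℕ} (hr : 0 < r)
    (s : C(Fin r → F, DistMeasure k C(I, F))) (hsec : IsDistSection (pathEval r F) s)
    (hs : ∀ (g : G) (f : Fin r → F), s (g • f) = g • s f) :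
    ∃ S : C(FiberProd r p, DistMeasure k (FiberPath p)), IsNavigationAlgorithm S := by
  have hex : ∀ e : FiberProd r p, ∃ (y : P) (f : Fin r → F),
      ∀ i, h (AssociatedSpace.mk G (f i) y) = e.1 i := by
    intro e
    obtain ⟨y, hy⟩ := hq.surjective (p (e.1 ⟨0, hr⟩))
    choose f hf using fun i => exists_homeomorph_mk_eq h hp hq (hy.trans (e.2 ⟨0, hr⟩ i))
    exact ⟨y, f, hf⟩
  choose y f hyf using hex
  refine ⟨⟨fun e => DistMeasure.map (fiberPathMap h hp (y e)) (s (f e)), ?_⟩, ?_⟩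
  · rw [continuous_iff_continuousAt]
    intro e₀
    obtain ⟨U, hU, hbU, sec, θ, h_sec, hq_sec, hθ, hθ_sec⟩ :=
      exists_local_coordinate h hp hq (p (e₀.1 ⟨0, hr⟩))
    have hpc : Continuous p := continuous_associated_proj h hp hq
    have hcoord : ∀ i, Continuous fun e : FiberProd r p => e.1 i := fun i =>
      (continuous_apply i).comp continuous_subtype_val
    have h_sec_cont : ContinuousAt (fun e : FiberProd r p => sec (p (e.1 ⟨0, hr⟩))) e₀ :=
      ContinuousAt.comp (f := fun e : FiberProd r p => p (e.1 ⟨0, hr⟩))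
        (h_sec.continuousAt (hU.mem_nhds hbU)) (hpc.comp (hcoord _)).continuousAt
    have hθc : ContinuousAt (fun (e : FiberProd r p) i => θ (e.1 i)) e₀ := by
      refine continuousAt_pi.2 fun i => ?_
      refine ContinuousAt.comp (f := fun e : FiberProd r p => e.1 i) ?_ (hcoord i).continuousAt
      refine hθ.continuousAt ((hU.preimage hpc).mem_nhds ?_)
      rw [mem_preimage, e₀.2 i ⟨0, hr⟩]
      exact hbU
    -- The chosen `y` and `f` need not be continuous; near `e₀` they are replaced by `sec` and `θ`,
    -- which yield the same measure.
    have hlim := (DistMeasure.continuous_map_uncurry (k := k) (fiberPathMap h hp)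
      (continuous_fiberPathMap_uncurry h hp)).continuousAt.comp
        (h_sec_cont.prodMk (s.continuous.continuousAt.comp hθc))
    refine hlim.congr ?_
    filter_upwards [(hU.preimage (hpc.comp (hcoord ⟨0, hr⟩))).mem_nhds hbU] with e he
    have hpU : ∀ i, p (e.1 i) ∈ U := fun i => by rw [e.2 i ⟨0, hr⟩]; exact he
    refine map_fiberPathMap_eq h hp hq hs ?_ fun i => ?_
    · refine (hq_sec _ he).trans ?_
      change p (e.1 ⟨0, hr⟩) = _
      rw [← hyf e ⟨0, hr⟩, hp]
    · change h (AssociatedSpace.mk G (θ (e.1 i)) (sec (p (e.1 ⟨0, hr⟩)))) = _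
      rw [hyf e i, e.2 ⟨0, hr⟩ i]
      exact hθ_sec _ (hpU i)
  · intro e γ hγ i
    obtain ⟨φ, hφ, rfl⟩ := DistMeasure.exists_mem_supp_of_mem_supp_map hγ
    have hφi : φ (seqTime r i) = f e i := congrFun (hsec (f e) hφ) i
    change h (AssociatedSpace.mk G (φ (seqTime r i)) (y e)) = _
    rw [hφi, hyf]

theorem parametrizedDTC_le_equivariantDTC (h : AssociatedSpace G F P ≃ₜ E)
    (hp : ∀ (f : F) (y : P), p (h (AssociatedSpace.mk G f y)) = q y)
    (hq : IsPrincipalBundle G q) {r : ℕ} (hr : 0 < r) :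
    parametrizedDTC r p ≤ equivariantDTC G r F := by
  refine le_sInf ?_
  rintro N ⟨n, rfl, s, hsec, hs⟩
  obtain ⟨S, hS⟩ := exists_isNavigationAlgorithm h hp hq hr s hsec hs
  exact sInf_le ⟨n, rfl, S, hS⟩

end Associated

theorem le_add_one_sq_sub_one (N : ℕ∞) : N ≤ (N + 1) ^ 2 - 1 := by
  refine ENat.le_sub_of_add_le_right ENat.one_ne_top ?_
  rw [sq]
  exact le_mul_of_one_le_right' le_add_self

end DistTC

theorem mainTheorem7 {G F P E B : Type*}
    [Group G] [TopologicalSpace G] [IsTopologicalGroup G]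
    [MetricSpace F] [MulAction G F] [ContinuousSMul G F]
    [TopologicalSpace P] [MulAction G P] [ContinuousSMul G P]
    [TopologicalSpace B] [MetricSpace E]
    (q : P → B) (hq : DistTC.IsPrincipalBundle G q)
    (p : E → B) (h : DistTC.AssociatedSpace G F P ≃ₜ E)
    (hp : ∀ (f : F) (y : P), p (h (DistTC.AssociatedSpace.mk G f y)) = q y)
    (r : ℕ) (hr : 2 ≤ r) :
    DistTC.parametrizedDTC r p ≤ (DistTC.equivariantDTC G r F + 1) ^ 2 - 1 := by
  exact (DistTC.parametrizedDTC_le_equivariantDTC h hp hq (by omega)).trans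
    (DistTC.le_add_one_sq_sub_one _)
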